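/- Let $\boldsymbol{x}\sim\mathcal N(0,\Sigma_x)$ be a Gaussian random vector in $\mathbb R^p$ with $\Sigma_x\succ O$. Two senders observe $\boldsymbol{x}$ and simultaneously commit to Borel policies $\eta_1,\eta_2:\mathbb R^p\to\mathbb R^p$; the receiver observes $\boldsymbol{y}_j=\eta_j(\boldsymbol{x})$, $j=1,2$, and takes the action $\boldsymbol{u}=\gamma(\boldsymbol{y}_1,\boldsymbol{y}_2)\in\mathbb R^t$, where $\gamma:\mathbb R^{2p}\to\mathbb R^t$ is Borel. The expected costs are $J_k(\eta_1,\eta_2;\gamma)=\mathbb E\|Q_k\boldsymbol{x}+R_k\boldsymbol{u}\|^2$ for $k\in\{1,2,r\}$, with $Q_k\in\mathbb R^{q\times p}$, $R_k\in\mathbb R^{q\times t}$ and $R_r^\top R_r$ invertible. A best-response strategy of the receiver is a map $\gamma^*$ that assigns to each pair $(\eta_1,\eta_2)$ a minimizer $\gamma^*(\eta_1,\eta_2)$ of $\gamma\mapsto J_r(\eta_1,\eta_2;\gamma)$. The policies $(\eta_1,\eta_2)$ together with such a $\gamma^*$ form a Nash equilibrium among the senders if no sender $j$ can decrease $J_j(\eta_1,\eta_2;\gamma^*(\eta_1,\eta_2))$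 by changing $\eta_j$ alone to another Borel policy, the receiver re-responding through $\gamma^*$. Write $\hat{\boldsymbol{x}}=\mathbb E[\boldsymbol{x}\mid\boldsymbol{y}_1,\boldsymbol{y}_2]$; the posterior covariance induced by $(\eta_1,\eta_2)$ is $\mathbb E[\hat{\boldsymbol{x}}\hat{\boldsymbol{x}}^\top]$. For $j=1,2$ put $\Lambda_j=R_j(R_r^\top R_r)^{-1}R_r^\top Q_r$ and $V_j=\Lambda_j^\top\Lambda_j-\Lambda_j^\top Q_j-Q_j^\top\Lambda_j$. Let $\Sigma^*$ be obtained as follows, where $(i,k)$ is either $(1,2)$ or $(2,1)$ and $\|\cdot\|_*$ is the nuclear norm (sum of the singular values): 1. let $S_i$ minimize $\operatorname{Tr}(V_iS)$ over $\Sigma_x\succeq S\succeq O$, and let $\Sigma_i^*$ minimize $\|\Sigma_x^{-1/2}S\Sigma_x^{-1/2}\|_*$ over the $S$ with $\Sigma_x\succeq S\succeq O$ and $\operatorname{Tr}(V_iS)\le\operatorname{Tr}(V_iS_i)$; 2. let $S_k$ minimize $\operatorname{Tr}(V_kS)$ over $\Sigma_x\succeq S\succeq\Sigma_i^*$, and let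 $\Sigma^*$ minimize $\|\Sigma_x^{-1/2}S\Sigma_x^{-1/2}\|_*$ over the $S$ with $\Sigma_x\succeq S\succeq\Sigma_i^*$ and $\operatorname{Tr}(V_kS)\le\operatorname{Tr}(V_kS_k)$. Let $P'=\Sigma_x^{-1/2}\Sigma^*\Sigma_x^{-1/2}=U_{P'}\Lambda_{P'}U_{P'}^\top$ with $U_{P'}$ orthogonal and $\Lambda_{P'}$ diagonal, let $L^\top=\Sigma_x^{-1/2}U_{P'}\Lambda_{P'}$, and let $G_1,G_2\in\mathbb R^{p\times p}$ be arbitrary (full-rank) matrices with orthonormal columns. Then the receiver has a best-response strategy, and, with every best-response strategy of the receiver, the noiseless linear policies $\eta_1(\boldsymbol{x})=G_1L\boldsymbol{x}$ and $\eta_2(\boldsymbol{x})=G_2L\boldsymbol{x}$ form a Nash equilibrium among the senders. They induce the posterior covariance $\Sigma^*$, which is of the form $\Sigma^*=\Sigma_i^*+(\Sigma_x-\Sigma_i^*)^{1/2}P(\Sigma_x-\Sigma_i^*)^{1/2}$ for some orthogonal projection matrix $P$. -/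

import Mathlib

open MeasureTheory ProbabilityTheory
open scoped ENNReal Matrix MatrixOrder

noncomputable section

namespace SignalingGame

/-- Column vectors with the Euclidean norm. -/
abbrev Vec (n : ℕ) : Type := EuclideanSpace ℝ (Fin n)

/-- Multiplication of a Euclidean vector by a matrix. -/
abbrev act {m n : ℕ} (A : Matrix (Fin m) (Fin n) ℝ) (v : Vec n) : Vec m :=
  Matrix.toEuclideanLin A v

/-- The matrices of the quadratic losses `‖Qᵢ x + Rᵢ u‖²` of the two senders `i : Fin 2`
and `‖Qr x + Rr u‖²` of the receiver. -/
structure Losses (p q t : ℕ) where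
  Q : Fin 2 → Matrix (Fin q) (Fin p) ℝ
  R : Fin 2 → Matrix (Fin q) (Fin t) ℝ
  Qr : Matrix (Fin q) (Fin p) ℝ
  Rr : Matrix (Fin q) (Fin t) ℝ

/-! ### Policies, costs and equilibrium -/

/-- Policies of a sender: all Borel measurable maps `ℝᵖ → ℝᵖ`. -/
abbrev SenderPolicy (p : ℕ) : Type := {η : Vec p → Vec p // Measurable η}

/-- Policies of the receiver: all Borel measurable maps from the pair of signals to `ℝᵗ`. -/
abbrev ReceiverPolicy (p t : ℕ) : Type := {γ : (Fin 2 → Vec p) → Vec t // Measurable γ}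

/-- The noiseless linear policy `x ↦ A x`. -/
def linearPolicy {p : ℕ} (A : Matrix (Fin p) (Fin p) ℝ) : SenderPolicy p :=
  ⟨fun x => act A x, (LinearMap.continuous_of_finiteDimensional (Matrix.toEuclideanLin A)).measurable⟩

section game

variable {Ω : Type*} [MeasurableSpace Ω] {p q t : ℕ}

/-- The pair of signals `(η₁(x), η₂(x))` received by the receiver. -/
def signals (X : Ω → Vec p) (η : Fin 2 → SenderPolicy p) (ω : Ω) : Fin 2 → Vec p :=
  fun i => (η i).1 (X ω)

/-- The expected cost `𝔼 ‖Q x + R γ(y₁, y₂)‖²`; it is nonnegative and a priori possibly infinite. -/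
def expectedCost (P : Measure Ω) (X : Ω → Vec p)
    (Q : Matrix (Fin q) (Fin p) ℝ) (R : Matrix (Fin q) (Fin t) ℝ)
    (η : Fin 2 → SenderPolicy p) (γ : ReceiverPolicy p t) : ℝ≥0∞ :=
  ∫⁻ ω, ENNReal.ofReal (‖act Q (X ω) + act R (γ.1 (signals X η ω))‖ ^ 2) ∂P

/-- `γ` is a strategy of the receiver (a policy for each pair of committed sender policies) that
selects, for every pair of sender policies, a minimizer of the expected cost of the receiver. -/
def IsBestResponseStrategy (P : Measure Ω) (X : Ω → Vec p) (𝓛 : Losses p q t)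
    (γ : (Fin 2 → SenderPolicy p) → ReceiverPolicy p t) : Prop :=
  ∀ (η : Fin 2 → SenderPolicy p) (γ' : ReceiverPolicy p t),
    expectedCost P X 𝓛.Qr 𝓛.Rr η (γ η) ≤ expectedCost P X 𝓛.Qr 𝓛.Rr η γ'

/-- Nash equilibrium among the senders, the receiver following with a best response. -/
structure IsEquilibrium (P : Measure Ω) (X : Ω → Vec p) (𝓛 : Losses p q t)
    (η : Fin 2 → SenderPolicy p)
    (γ : (Fin 2 → SenderPolicy p) → ReceiverPolicy p t) : Prop where
  best_response : IsBestResponseStrategy P X 𝓛 γ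
  no_deviation : ∀ (i : Fin 2) (η' : SenderPolicy p),
    expectedCost P X (𝓛.Q i) (𝓛.R i) η (γ η) ≤
      expectedCost P X (𝓛.Q i) (𝓛.R i)
        (Function.update η i η') (γ (Function.update η i η'))

/-- The posterior mean `x̂ = 𝔼[x | y₁, y₂]` of the receiver. -/
def posteriorMean (P : Measure Ω) (X : Ω → Vec p) (η : Fin 2 → SenderPolicy p) : Ω → Vec p :=
  P[X | MeasurableSpace.comap (signals X η) inferInstance]

/-- The posterior covariance `𝔼[x̂ x̂ᵀ]` (the state has mean zero). -/
def posteriorCovariance (P : Measure Ω) (X : Ω → Vec p) (η : Fin 2 → SenderPolicy p) :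
    Matrix (Fin p) (Fin p) ℝ :=
  Matrix.of fun j k => ∫ ω, posteriorMean P X η ω j * posteriorMean P X η ω k ∂P

end game

/-! ### The sequential semidefinite programs -/

/-- `Λᵢ = Rᵢ (Rrᵀ Rr)⁻¹ Rrᵀ Qr`. -/
def Losses.lam {p q t : ℕ} (𝓛 : Losses p q t) (i : Fin 2) : Matrix (Fin q) (Fin p) ℝ :=
  𝓛.R i * (𝓛.Rrᵀ * 𝓛.Rr)⁻¹ * 𝓛.Rrᵀ * 𝓛.Qr

/-- `Vᵢ = Λᵢᵀ Λᵢ - Λᵢᵀ Qᵢ - Qᵢᵀ Λᵢ`. -/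
def Losses.V {p q t : ℕ} (𝓛 : Losses p q t) (i : Fin 2) : Matrix (Fin p) (Fin p) ℝ :=
  (𝓛.lam i)ᵀ * 𝓛.lam i - (𝓛.lam i)ᵀ * 𝓛.Q i - (𝓛.Q i)ᵀ * 𝓛.lam i

/-- The nuclear norm: the sum of the singular values, i.e. of the square roots of the
eigenvalues of `Aᵀ A`. -/
def nuclearNorm {p : ℕ} (A : Matrix (Fin p) (Fin p) ℝ) : ℝ :=
  ∑ j, √((Matrix.isHermitian_conjTranspose_mul_self A).eigenvalues j)

/-- The normalization `Σx^{-1/2} S Σx^{-1/2}`. -/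
def whiten {p : ℕ} (Sx S : Matrix (Fin p) (Fin p) ℝ) : Matrix (Fin p) (Fin p) ℝ :=
  (CFC.sqrt Sx)⁻¹ * S * (CFC.sqrt Sx)⁻¹

/-- One stage: `S'` is obtained by first computing a minimizer `S` of `Tr (V S)` over
`Σx ⪰ S ⪰ S₀` and then minimizing the nuclear norm of `Σx^{-1/2} S' Σx^{-1/2}` over
`Σx ⪰ S' ⪰ S₀` subject to `Tr (V S) ≥ Tr (V S')`. Intervals are in the Loewner order. -/
def IsStageOutput {p : ℕ} (Sx V S₀ S' : Matrix (Fin p) (Fin p) ℝ) : Prop :=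
  ∃ S ∈ Set.Icc S₀ Sx,
    IsMinOn (fun T => (V * T).trace) (Set.Icc S₀ Sx) S ∧
    S' ∈ Set.Icc S₀ Sx ∩ {T | (V * T).trace ≤ (V * S).trace} ∧
    IsMinOn (fun T => nuclearNorm (whiten Sx T))
      (Set.Icc S₀ Sx ∩ {T | (V * T).trace ≤ (V * S).trace}) S'

/-- `S` is a posterior covariance returned by the two-stage algorithm which treats sender `i`
first, with intermediate posterior covariance `S₁`, and the other sender second. -/
def IsAlgorithmOutput {p q t : ℕ} (Sx : Matrix (Fin p) (Fin p) ℝ) (𝓛 : Losses p q t)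
    (i : Fin 2) (S₁ S : Matrix (Fin p) (Fin p) ℝ) : Prop :=
  IsStageOutput Sx (𝓛.V i) 0 S₁ ∧ IsStageOutput Sx (𝓛.V i.rev) S₁ S

end SignalingGame

end

namespace SignalingGame

/-! ### Matrix preliminaries -/

section matrix

variable {p : ℕ} {A B T T₀ W : Matrix (Fin p) (Fin p) ℝ}

/-! The receiver's problem is least squares, so every best response equals `-K x̂` almost surely.
Substituting it turns the cost of sender `j` into a constant plus `Tr (Vⱼ S)`, with `S` the
posterior covariance (`linearResponseCost_sender`). Against these linear policies deviations are
easily controlled: the sender who stays reveals `L x`, so the deviator can only refine the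
information and the new covariance lies in `[Σ*, Σx]`. It therefore suffices that `Σ*` minimizes `Tr
(Vⱼ S)` over `[Σ*, Σx]` for both senders. For the sender treated second this holds because the
interval has shrunk. For the one treated first, translation by `Σᵢ* - Σ*` carries `[Σ*, Σx]` into
the interval where `Σᵢ*` is optimal (`IsStageOutput.trace_le_of_le`).

It remains to realize `Σ*` by linear policies. The nuclear norm step makes the whitened output `T` a
projection (`IsStageOutput.whiten_mul_self`). Then the error of the estimate `Σx^{1/2} T Σx^{-1/2}
x` is uncorrelated with `L x`, hence independent of it for Gaussian `x`, so the estimate is the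
posterior mean and its covariance is `Σ*`. The stated form of `Σ*` comes from the nested whitened
projections of the two stages (`exists_isStarProjection_conj`). -/

theorem nonneg_conj (hW : Wᵀ = W) (hA : 0 ≤ A) : 0 ≤ W * A * W := by
  have h := (Matrix.nonneg_iff_posSemidef.1 hA).conjTranspose_mul_mul_same W
  rw [Matrix.conjTranspose_eq_transpose_of_trivial, hW] at h
  exact h.nonneg

theorem conj_le_conj (hW : Wᵀ = W) (h : A ≤ B) : W * A * W ≤ W * B * W := by
  rw [← sub_nonneg] at h ⊢
  have h' := nonneg_conj hW h
  rwa [mul_sub, sub_mul] at h'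

theorem transpose_eq_of_nonneg (hA : 0 ≤ A) : Aᵀ = A := by
  have h := (Matrix.nonneg_iff_posSemidef.1 hA).isHermitian.eq
  rwa [Matrix.conjTranspose_eq_transpose_of_trivial] at h

/-- With `A = Yᴴ Y`, the hypothesis says `(Y W)ᴴ (Y W) = 0`, so `Y W = 0`. -/
theorem mul_eq_zero_of_conj_eq_zero (hW : Wᵀ = W) (hA : 0 ≤ A) (h : W * A * W = 0) :
    A * W = 0 := by
  obtain ⟨Y, rfl⟩ := CStarAlgebra.nonneg_iff_eq_star_mul_self.mp hA
  have hY : Y * W = 0 := by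
    rw [← Matrix.conjTranspose_mul_self_eq_zero, ← h, Matrix.conjTranspose_mul,
      Matrix.conjTranspose_eq_transpose_of_trivial W, hW]
    simp only [Matrix.star_eq_conjTranspose, mul_assoc]
  rw [mul_assoc, hY, mul_zero]

theorem nonneg_mul_self (hA : Aᵀ = A) : 0 ≤ A * A := by
  have h := Matrix.posSemidef_conjTranspose_mul_self A
  rw [Matrix.conjTranspose_eq_transpose_of_trivial, hA] at h
  exact h.nonneg

/-- A contraction above an orthogonal projection fixes its range. -/
theorem mul_eq_of_isIdempotent_le (hW : Wᵀ = W) (hid : W * W = W) (h₀ : W ≤ T) (h₁ : T ≤ 1) :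
    T * W = W := by
  have hle : W * (1 - T) * W = 0 := by
    apply le_antisymm
    · have h := conj_le_conj hW (sub_le_sub_left h₀ 1)
      have e : W * (1 - W) * W = 0 := by rw [mul_sub, mul_one, hid, sub_self, zero_mul]
      rwa [e] at h
    · exact nonneg_conj hW (sub_nonneg.2 h₁)
  have h := mul_eq_zero_of_conj_eq_zero hW (sub_nonneg.2 h₁) hle
  rw [sub_mul, one_mul, sub_eq_zero] at h
  exact h.symm

theorem mul_self_le_self (h₀ : 0 ≤ T) (h₁ : T ≤ 1) : T * T ≤ T := by
  have hT := transpose_eq_of_nonneg h₀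
  have a := nonneg_conj hT (sub_nonneg.2 h₁)
  have b := nonneg_conj (transpose_eq_of_nonneg (sub_nonneg.2 h₁)) h₀
  rw [← sub_nonneg]
  have e : T - T * T = T * (1 - T) * T + (1 - T) * T * (1 - T) := by noncomm_ring
  rw [e]
  exact add_nonneg a b

theorem trace_nonneg_of_nonneg (hA : 0 ≤ A) : 0 ≤ A.trace := (Matrix.nonneg_iff_posSemidef.1 hA).trace_nonneg

/-- A positive semidefinite matrix of trace zero vanishes; this turns a comparison of nuclear norms
into an equality of matrices. -/
theorem eq_of_le_of_trace_le (h : A ≤ B) (ht : B.trace ≤ A.trace) : A = B := by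
  have h' := Matrix.nonneg_iff_posSemidef.1 (sub_nonneg.2 h)
  have h0 : (B - A).trace = 0 :=
    le_antisymm (by rw [Matrix.trace_sub]; linarith) h'.trace_nonneg
  rw [h'.trace_eq_zero_iff, sub_eq_zero] at h0
  exact h0.symm

/-- The nuclear norm of a positive semidefinite matrix is its trace. -/
theorem nuclearNorm_eq_trace (hA : 0 ≤ A) : nuclearNorm A = A.trace := by
  set h := Matrix.isHermitian_conjTranspose_mul_self A
  -- `A` is the positive square root of `Aᴴ A`; diagonalizing that root makes its trace the sum of
  -- the singular values.
  have e : cfc Real.sqrt (Aᴴ * A) = A := by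
    have h1 : CFC.sqrt (Aᴴ * A) = A := by
      rw [CFC.sqrt_eq_iff _ _ (Matrix.posSemidef_conjTranspose_mul_self A).nonneg hA,
        (Matrix.nonneg_iff_posSemidef.1 hA).isHermitian.eq]
    rwa [CFC.sqrt_eq_real_sqrt _ (Matrix.posSemidef_conjTranspose_mul_self A).nonneg,
      cfcₙ_eq_cfc] at h1
  conv_rhs => rw [← e, h.cfc_eq, Matrix.IsHermitian.cfc, Unitary.conjStarAlgAut_apply,
    Matrix.trace_mul_cycle]
  simp [nuclearNorm, Matrix.trace]

/-! ### Whitening and the optimality of stage outputs. -/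

variable {Sx S S₀ S' V : Matrix (Fin p) (Fin p) ℝ}

theorem transpose_sqrt (Sx : Matrix (Fin p) (Fin p) ℝ) : (CFC.sqrt Sx)ᵀ = CFC.sqrt Sx :=
  transpose_eq_of_nonneg (CFC.sqrt_nonneg Sx)

theorem transpose_inv_sqrt (Sx : Matrix (Fin p) (Fin p) ℝ) :
    ((CFC.sqrt Sx)⁻¹)ᵀ = (CFC.sqrt Sx)⁻¹ := by
  rw [Matrix.transpose_nonsing_inv, transpose_sqrt]

theorem isUnit_det_sqrt (hSx : Sx.PosDef) : IsUnit (CFC.sqrt Sx).det := by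
  have h := hSx.isUnit
  rw [← CFC.sqrt_mul_sqrt_self Sx hSx.posSemidef.nonneg, Matrix.isUnit_iff_isUnit_det,
    Matrix.det_mul] at h
  exact isUnit_of_mul_isUnit_left h

theorem whiten_conj (hSx : Sx.PosDef) (A : Matrix (Fin p) (Fin p) ℝ) :
    whiten Sx (CFC.sqrt Sx * A * CFC.sqrt Sx) = A := by
  have h := isUnit_det_sqrt hSx
  rw [whiten, mul_assoc, mul_assoc, Matrix.mul_nonsing_inv _ h, mul_one, ← mul_assoc,
    Matrix.nonsing_inv_mul _ h, one_mul]

theorem conj_whiten (hSx : Sx.PosDef) (A : Matrix (Fin p) (Fin p) ℝ) :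
    CFC.sqrt Sx * whiten Sx A * CFC.sqrt Sx = A := by
  have h := isUnit_det_sqrt hSx
  rw [whiten, mul_assoc, mul_assoc, Matrix.nonsing_inv_mul _ h, mul_one, ← mul_assoc,
    Matrix.mul_nonsing_inv _ h, one_mul]

theorem conj_one (hSx : Sx.PosDef) : CFC.sqrt Sx * 1 * CFC.sqrt Sx = Sx := by
  rw [mul_one, CFC.sqrt_mul_sqrt_self Sx hSx.posSemidef.nonneg]

theorem whiten_mono (h : A ≤ B) : whiten Sx A ≤ whiten Sx B :=
  conj_le_conj (transpose_inv_sqrt Sx) h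

theorem whiten_self (hSx : Sx.PosDef) : whiten Sx Sx = 1 := by
  nth_rw 2 [← conj_one hSx]
  exact whiten_conj hSx 1

/-- If the lower end of the interval is the image of a projection, then so is the output of
the stage: `T²` and `2T - T²` are feasible with midpoint `T`, so `T²` is optimal too, and
it has smaller nuclear norm unless `T² = T`. -/
theorem IsStageOutput.whiten_mul_self (hSx : Sx.PosDef) (h : IsStageOutput Sx V S₀ S')
    (hS₀ : 0 ≤ S₀) (hid : whiten Sx S₀ * whiten Sx S₀ = whiten Sx S₀) :
    whiten Sx S' * whiten Sx S' = whiten Sx S' := by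
  obtain ⟨S, -, hmin, ⟨⟨hl, hu⟩, htr⟩, hnuc⟩ := h
  set T := whiten Sx S' with hTdef
  set T₀ := whiten Sx S₀ with hT₀def
  have hz : whiten Sx 0 = 0 := by simp [whiten]
  have h0T₀ : 0 ≤ T₀ := by rw [← hz]; exact whiten_mono hS₀
  have hT₀T : T₀ ≤ T := whiten_mono hl
  have hT1 : T ≤ 1 := by rw [← whiten_self hSx]; exact whiten_mono hu
  have h0T : 0 ≤ T := h0T₀.trans hT₀T
  have htT := transpose_eq_of_nonneg h0T
  have htT₀ := transpose_eq_of_nonneg h0T₀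
  have hTT := mul_self_le_self h0T hT1
  have e1 : T * T₀ = T₀ := mul_eq_of_isIdempotent_le htT₀ hid hT₀T hT1
  have e2 : T₀ * T = T₀ := by
    have := congrArg Matrix.transpose e1
    rwa [Matrix.transpose_mul, htT, htT₀] at this
  -- The only use of `T₀` being a projection: `T` fixes its range, so `T² - T₀` is the square of `T
  -- - T₀`.
  have hsq : T₀ ≤ T * T := by
    rw [← sub_nonneg]
    have e : T * T - T₀ = (T - T₀) * (T - T₀) := by
      rw [sub_mul, mul_sub, mul_sub, e1, e2, hid]; abel
    rw [e]
    exact nonneg_mul_self (by rw [Matrix.transpose_sub, htT, htT₀])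
  have hrefl : T + T - T * T ≤ 1 := by
    rw [← sub_nonneg]
    have e : 1 - (T + T - T * T) = (1 - T) * (1 - T) := by noncomm_ring
    rw [e]
    exact nonneg_mul_self (by rw [Matrix.transpose_sub, htT, Matrix.transpose_one])
  have hmem : ∀ Z, T₀ ≤ Z → Z ≤ 1 → CFC.sqrt Sx * Z * CFC.sqrt Sx ∈ Set.Icc S₀ Sx := by
    intro Z h1 h2
    constructor
    · have := conj_le_conj (transpose_sqrt Sx) h1
      rwa [conj_whiten hSx] at this
    · have := conj_le_conj (transpose_sqrt Sx) h2
      rwa [conj_one hSx] at this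
  have hA := hmem (T * T) hsq (hTT.trans hT1)
  have hB := hmem (T + T - T * T)
    (hT₀T.trans (by rw [add_sub_assoc]; exact le_add_of_nonneg_right (sub_nonneg.2 hTT))) hrefl
  have hmA := isMinOn_iff.1 hmin _ hA
  have hmB := isMinOn_iff.1 hmin _ hB
  have hsum : (V * (CFC.sqrt Sx * (T * T) * CFC.sqrt Sx)).trace +
      (V * (CFC.sqrt Sx * (T + T - T * T) * CFC.sqrt Sx)).trace =
      (V * S').trace + (V * S').trace := by
    rw [← Matrix.trace_add, ← Matrix.trace_add, ← conj_whiten hSx S', ← hTdef]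
    congr 1
    noncomm_ring
  rw [Set.mem_ofPred_eq] at htr
  -- Neither of the two traces is below the minimum, and their sum is at most twice the minimum, so
  -- both equal it.
  have hAfeas : CFC.sqrt Sx * (T * T) * CFC.sqrt Sx ∈
      Set.Icc S₀ Sx ∩ {T | (V * T).trace ≤ (V * S).trace} := by
    refine ⟨hA, ?_⟩
    rw [Set.mem_ofPred_eq]
    linarith
  have hn := isMinOn_iff.1 hnuc _ hAfeas
  rw [whiten_conj hSx, ← hTdef, nuclearNorm_eq_trace h0T,
    nuclearNorm_eq_trace (h0T₀.trans hsq)] at hn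
  exact eq_of_le_of_trace_le hTT hn

theorem IsStageOutput.mem_Icc (h : IsStageOutput Sx V S₀ S') : S' ∈ Set.Icc S₀ Sx := by
  obtain ⟨S, -, -, h, -⟩ := h
  exact h.1

theorem IsStageOutput.trace_le (h : IsStageOutput Sx V S₀ S') {T : Matrix (Fin p) (Fin p) ℝ}
    (hT : T ∈ Set.Icc S₀ Sx) : (V * S').trace ≤ (V * T).trace := by
  obtain ⟨S, -, hmin, h, -⟩ := h
  exact h.2.trans (isMinOn_iff.1 hmin _ hT)

/-- A stage output is also optimal, within the interval it starts, for the translated problem. -/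
theorem IsStageOutput.trace_le_of_le (h : IsStageOutput Sx V S₀ S') (hSS : S' ≤ S)
    {T : Matrix (Fin p) (Fin p) ℝ} (hT : T ∈ Set.Icc S Sx) : (V * S).trace ≤ (V * T).trace := by
  have hm := h.mem_Icc
  -- The competitor `S' + (T - S)` lies above `S'` because `S ≤ T`, and below `T` because `S' ≤ S`.
  -- Linearity of the trace then cancels `S'`.
  have h1 := h.trace_le (T := S' + (T - S)) ⟨hm.1.trans (le_add_of_nonneg_right
    (sub_nonneg.2 hT.1)), by
      calc S' + (T - S) = T - (S - S') := by abel
        _ ≤ T := sub_le_self _ (sub_nonneg.2 hSS)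
        _ ≤ Sx := hT.2⟩
  rw [mul_add, mul_sub, Matrix.trace_add, Matrix.trace_sub] at h1
  linarith

/-! ### Projection form of the second-stage output. -/

/-- The Moore-Penrose inverse of a positive semidefinite matrix, via functional calculus. -/
theorem exists_pseudoInverse (hA : 0 ≤ A) :
    ∃ K : Matrix (Fin p) (Fin p) ℝ, Kᵀ = K ∧ A * K = K * A ∧ A * K * A = A := by
  have hsa : IsSelfAdjoint A := (Matrix.nonneg_iff_posSemidef.1 hA).isHermitian
  have hf : ∀ f : ℝ → ℝ, ContinuousOn f (spectrum ℝ A) := fun f =>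
    (Matrix.finite_real_spectrum).continuousOn f
  -- With the convention `0⁻¹ = 0`, the identity `x * x⁻¹ * x = x` also holds at the eigenvalue `0`;
  -- continuity is free on a finite spectrum.
  refine ⟨cfc (fun x : ℝ => x⁻¹) A, ?_, ?_, ?_⟩
  · have : IsSelfAdjoint (cfc (fun x : ℝ => x⁻¹) A) := cfc_predicate _ _
    rw [← Matrix.conjTranspose_eq_transpose_of_trivial]
    exact this
  · nth_rw 1 4 [← cfc_id' ℝ A]
    exact cfc_commute_cfc _ _ A
  · nth_rw 1 3 4 [← cfc_id' ℝ A]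
    rw [← cfc_mul _ _ A (hf _) (hf _), ← cfc_mul _ _ A (hf _) (hf _)]
    exact cfc_congr fun x _ => mul_inv_mul_cancel x

/-- If `M² = R Q R` with `R` invertible and symmetric and `Q` a projection, then `R Z R` for a
projection `Z ≤ Q` is of the form `M Pr M` with a projection `Pr`. -/
theorem exists_isStarProjection_conj {M R Q Z : Matrix (Fin p) (Fin p) ℝ} (hM : 0 ≤ M)
    (hR : Rᵀ = R) (hRu : IsUnit R.det) (hMR : M * M = R * Q * R) (hQt : Qᵀ = Q)
    (hQ : Q * Q = Q) (hZt : Zᵀ = Z) (hZ : Z * Z = Z) (hQZ : Q * Z = Z) :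
    ∃ Pr : Matrix (Fin p) (Fin p) ℝ, IsStarProjection Pr ∧ R * Z * R = M * Pr * M := by
  obtain ⟨K, hKt, hcomm, hK⟩ := exists_pseudoInverse hM
  have hMt := transpose_eq_of_nonneg hM
  have hZQ : Z * Q = Z := by
    have := congrArg Matrix.transpose hQZ
    rwa [Matrix.transpose_mul, hQt, hZt] at this
  have hMMK : M * M * K = M := by rw [mul_assoc, hcomm, ← mul_assoc, hK]
  have hKMM : K * M * M = M := by rw [← hcomm, hK]
  -- the range of `Q R` is recovered from that of `M`
  have hker : Q * R * (1 - K * M) = 0 := by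
    rw [← Matrix.conjTranspose_mul_self_eq_zero, Matrix.conjTranspose_mul,
      Matrix.conjTranspose_eq_transpose_of_trivial (Q * R), Matrix.transpose_mul, hR, hQt]
    have : R * Q * (Q * R * (1 - K * M)) = 0 := by
      calc R * Q * (Q * R * (1 - K * M)) = R * (Q * Q) * R * (1 - K * M) := by
            simp only [mul_assoc]
        _ = M * M - M * (M * K * M) := by rw [hQ, ← hMR, mul_sub, mul_one]; simp only [mul_assoc]
        _ = 0 := by rw [hK, sub_self]
    rw [mul_assoc, this, mul_zero]
  have hQRKM : Q * R * (K * M) = Q * R := by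
    rw [mul_sub, mul_one, sub_eq_zero] at hker; exact hker.symm
  have hMKRQ : M * K * (R * Q) = R * Q := by
    have := congrArg Matrix.transpose hQRKM
    rwa [Matrix.transpose_mul, Matrix.transpose_mul, Matrix.transpose_mul, hR, hQt, hKt,
      hMt] at this
  -- `Q R K` is a partial isometry with final projection `Q`; the identity is checked after
  -- multiplying by the invertible `R`.
  have hproj : Q * R * K * (K * R * Q) = Q := by
    have h1 : Q * R * K * (K * R * Q) * R = Q * R := by
      calc Q * R * K * (K * R * Q) * R = Q * R * (K * (K * (R * Q * R))) := by
            simp only [mul_assoc]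
        _ = Q * R * (K * M) := by rw [← hMR, ← mul_assoc K M M, hKMM]
        _ = Q * R := hQRKM
    have h2 := congrArg (· * R⁻¹) h1
    simpa only [mul_assoc, Matrix.mul_nonsing_inv _ hRu, mul_one] using h2
  -- This is `Z` conjugated by the partial isometry `Q R K`, the outer factors `Q` being absorbed by
  -- `Z`.
  refine ⟨K * R * Z * R * K, ⟨?_, ?_⟩, ?_⟩
  · calc K * R * Z * R * K * (K * R * Z * R * K)
        = K * R * (Z * Q) * R * K * (K * R * (Q * Z) * R * K) := by rw [hZQ, hQZ]
      _ = K * R * Z * (Q * R * K * (K * R * Q)) * Z * R * K := by simp only [mul_assoc]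
      _ = K * R * (Z * Z) * R * K := by rw [hproj, mul_assoc _ Z Q, hZQ]; simp only [mul_assoc]
      _ = K * R * Z * R * K := by rw [hZ]
  · rw [IsSelfAdjoint, Matrix.star_eq_conjTranspose, Matrix.conjTranspose_eq_transpose_of_trivial]
    simp only [Matrix.transpose_mul, hKt, hR, hZt, mul_assoc]
  · symm
    calc M * (K * R * Z * R * K) * M
        = M * (K * R * (Q * Z * Q) * R * K) * M := by rw [hQZ, hZQ]
      _ = (M * K * (R * Q)) * Z * (Q * R * (K * M)) := by simp only [mul_assoc]
      _ = R * (Q * Z * Q) * R := by rw [hMKRQ, hQRKM]; simp only [mul_assoc]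
      _ = R * Z * R := by rw [hQZ, hZQ]

end matrix


/-! ### Second moments -/

section moments

variable {Ω : Type*} {mΩ : MeasurableSpace Ω} {P : Measure Ω} {l m n k : ℕ}

theorem act_apply (A : Matrix (Fin m) (Fin n) ℝ) (v : Vec n) (j : Fin m) :
    act A v j = ∑ i, A j i * v i := by
  simp [act, Matrix.toLpLin_apply, Matrix.mulVec, dotProduct]

theorem act_mul (A : Matrix (Fin l) (Fin m) ℝ) (B : Matrix (Fin m) (Fin n) ℝ) (v : Vec n) :
    act (A * B) v = act A (act B v) := by
  simp [act, Matrix.toLpLin_apply, Matrix.mulVec_mulVec]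

theorem act_one (v : Vec n) : act (1 : Matrix (Fin n) (Fin n) ℝ) v = v := by
  simp [act]

theorem act_sub (A B : Matrix (Fin m) (Fin n) ℝ) (v : Vec n) :
    act (A - B) v = act A v - act B v := by
  simp [act, map_sub]

theorem continuous_act (A : Matrix (Fin m) (Fin n) ℝ) : Continuous (act A) :=
  LinearMap.continuous_of_finiteDimensional (Matrix.toEuclideanLin A)

theorem memLp_act (A : Matrix (Fin m) (Fin n) ℝ) {f : Ω → Vec n} (hf : MemLp f 2 P) :
    MemLp (fun ω => act A (f ω)) 2 P :=
  (LinearMap.toContinuousLinearMap (Matrix.toEuclideanLin A)).comp_memLp' hf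

theorem memLp_coord {f : Ω → Vec n} (hf : MemLp f 2 P) (j : Fin n) :
    MemLp (fun ω => f ω j) 2 P :=
  (EuclideanSpace.proj (𝕜 := ℝ) j).comp_memLp' hf

theorem integrable_coord_mul {f : Ω → Vec m} {g : Ω → Vec n} (hf : MemLp f 2 P)
    (hg : MemLp g 2 P) (i : Fin m) (j : Fin n) : Integrable (fun ω => f ω i * g ω j) P :=
  (memLp_coord hf i).integrable_mul (memLp_coord hg j)

/-- The matrix `𝔼[f gᵀ]`. -/
noncomputable def secondMoment (P : Measure Ω) (f : Ω → Vec m) (g : Ω → Vec n) : Matrix (Fin m) (Fin n) ℝ :=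
  Matrix.of fun i j => ∫ ω, f ω i * g ω j ∂P

theorem secondMoment_transpose (f : Ω → Vec m) (g : Ω → Vec n) :
    (secondMoment P f g)ᵀ = secondMoment P g f := by
  ext i j
  simp [secondMoment, mul_comm]

theorem secondMoment_congr {f f' : Ω → Vec m} {g g' : Ω → Vec n} (hf : f =ᵐ[P] f')
    (hg : g =ᵐ[P] g') : secondMoment P f g = secondMoment P f' g' := by
  ext i j
  refine integral_congr_ae ?_
  filter_upwards [hf, hg] with ω h1 h2
  rw [h1, h2]

theorem secondMoment_add_left {f f' : Ω → Vec m} {g : Ω → Vec n} (hf : MemLp f 2 P)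
    (hf' : MemLp f' 2 P) (hg : MemLp g 2 P) :
    secondMoment P (fun ω => f ω + f' ω) g = secondMoment P f g + secondMoment P f' g := by
  ext i j
  simp only [secondMoment, Matrix.of_apply, Matrix.add_apply, PiLp.add_apply, add_mul]
  exact integral_add (integrable_coord_mul hf hg i j) (integrable_coord_mul hf' hg i j)

theorem secondMoment_add_right {f : Ω → Vec m} {g g' : Ω → Vec n} (hf : MemLp f 2 P)
    (hg : MemLp g 2 P) (hg' : MemLp g' 2 P) :
    secondMoment P f (fun ω => g ω + g' ω) = secondMoment P f g + secondMoment P f g' := by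
  rw [← secondMoment_transpose, secondMoment_add_left hg hg' hf, Matrix.transpose_add,
    secondMoment_transpose, secondMoment_transpose]

theorem secondMoment_sub_left {f f' : Ω → Vec m} {g : Ω → Vec n} (hf : MemLp f 2 P)
    (hf' : MemLp f' 2 P) (hg : MemLp g 2 P) :
    secondMoment P (fun ω => f ω - f' ω) g = secondMoment P f g - secondMoment P f' g := by
  ext i j
  simp only [secondMoment, Matrix.of_apply, Matrix.sub_apply, PiLp.sub_apply, sub_mul]
  exact integral_sub (integrable_coord_mul hf hg i j) (integrable_coord_mul hf' hg i j)

theorem secondMoment_sub_right {f : Ω → Vec m} {g g' : Ω → Vec n} (hf : MemLp f 2 P)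
    (hg : MemLp g 2 P) (hg' : MemLp g' 2 P) :
    secondMoment P f (fun ω => g ω - g' ω) = secondMoment P f g - secondMoment P f g' := by
  rw [← secondMoment_transpose, secondMoment_sub_left hg hg' hf, Matrix.transpose_sub,
    secondMoment_transpose, secondMoment_transpose]

theorem secondMoment_act_left (A : Matrix (Fin l) (Fin m) ℝ) {f : Ω → Vec m} {g : Ω → Vec n}
    (hf : MemLp f 2 P) (hg : MemLp g 2 P) :
    secondMoment P (fun ω => act A (f ω)) g = A * secondMoment P f g := by
  ext i j
  simp only [secondMoment, Matrix.of_apply, Matrix.mul_apply, act_apply, Finset.sum_mul,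
    mul_assoc]
  rw [integral_finsetSum _ fun a _ => (integrable_coord_mul hf hg a j).const_mul _]
  simp only [integral_const_mul]

theorem secondMoment_act_right (A : Matrix (Fin l) (Fin n) ℝ) {f : Ω → Vec m} {g : Ω → Vec n}
    (hf : MemLp f 2 P) (hg : MemLp g 2 P) :
    secondMoment P f (fun ω => act A (g ω)) = secondMoment P f g * Aᵀ := by
  rw [← secondMoment_transpose, secondMoment_act_left A hg hf, Matrix.transpose_mul,
    secondMoment_transpose]

theorem secondMoment_self_nonneg {f : Ω → Vec n} (hf : MemLp f 2 P) :
    0 ≤ secondMoment P f f := by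
  rw [Matrix.nonneg_iff_posSemidef]
  refine Matrix.PosSemidef.of_dotProduct_mulVec_nonneg ?_ fun v => ?_
  · rw [Matrix.IsHermitian, Matrix.conjTranspose_eq_transpose_of_trivial,
      secondMoment_transpose]
  -- The quadratic form at `v` is the second moment of the scalar `v ⬝ f`, encoded by a one-row
  -- matrix.
  · have h := secondMoment_act_right (Matrix.of fun (_ : Fin 1) j => v j)
      (memLp_act (Matrix.of fun (_ : Fin 1) j => v j) hf) hf
    rw [secondMoment_act_left _ hf hf] at h
    have h0 := congrFun (congrFun h 0) 0
    have hpos : 0 ≤ secondMoment P (fun ω => act (Matrix.of fun (_ : Fin 1) j => v j) (f ω))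
        (fun ω => act (Matrix.of fun (_ : Fin 1) j => v j) (f ω)) 0 0 :=
      integral_nonneg fun ω => mul_self_nonneg _
    rw [h0] at hpos
    refine hpos.trans_eq ?_
    rw [Matrix.mul_assoc, Matrix.mul_apply]
    simp [dotProduct, Matrix.mulVec, Matrix.mul_apply]

theorem integrable_norm_sq {f : Ω → Vec n} (hf : MemLp f 2 P) :
    Integrable (fun ω => ‖f ω‖ ^ 2) P := hf.integrable_norm_pow (by norm_num)

theorem integral_norm_sq {f : Ω → Vec n} (hf : MemLp f 2 P) :
    ∫ ω, ‖f ω‖ ^ 2 ∂P = (secondMoment P f f).trace := by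
  simp_rw [EuclideanSpace.real_norm_sq_eq, Matrix.trace, secondMoment, Matrix.diag_apply,
    Matrix.of_apply, sq]
  rw [integral_finsetSum _ fun a _ => integrable_coord_mul hf hf a a]

theorem lintegral_norm_sq {f : Ω → Vec n} (hf : MemLp f 2 P) :
    ∫⁻ ω, ENNReal.ofReal (‖f ω‖ ^ 2) ∂P = ENNReal.ofReal (secondMoment P f f).trace := by
  rw [← integral_norm_sq hf, ofReal_integral_eq_lintegral_ofReal (integrable_norm_sq hf)
    (Filter.Eventually.of_forall fun ω => by positivity)]

theorem memLp_two_of_lintegral_norm_sq {f : Ω → Vec n} (hf : AEStronglyMeasurable f P)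
    (h : ∫⁻ ω, ENNReal.ofReal (‖f ω‖ ^ 2) ∂P ≠ ∞) : MemLp f 2 P := by
  rw [memLp_two_iff_integrable_sq_norm hf]
  refine ⟨(hf.norm.pow 2), ?_⟩
  rw [hasFiniteIntegral_iff_ofReal (Filter.Eventually.of_forall fun ω => by positivity)]
  exact lt_of_le_of_ne le_top h

theorem ae_eq_zero_of_trace_secondMoment {f : Ω → Vec n} (hf : MemLp f 2 P)
    (h : (secondMoment P f f).trace ≤ 0) : f =ᵐ[P] 0 := by
  rw [← integral_norm_sq hf] at h
  have h0 := le_antisymm h (integral_nonneg fun ω => by positivity)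
  rw [integral_eq_zero_iff_of_nonneg (fun ω => by positivity) (integrable_norm_sq hf)] at h0
  filter_upwards [h0] with ω hω
  simpa using hω

end moments

/-! ### Conditional expectations -/

section condExp

variable {Ω : Type*} {m m' mΩ : MeasurableSpace Ω} {P : Measure Ω} {n k : ℕ} {X : Ω → Vec n}

theorem memLp_condExp (hX : MemLp X 2 P) : MemLp (P[X | m]) 2 P := hX.condExp (by norm_num)

/-- Pythagoras: the hypothesis makes `g - f` orthogonal to `f`, so the difference of the two sides
is the second moment of `g - f`. -/
theorem secondMoment_le_of_eq {f g : Ω → Vec n} (hf : MemLp f 2 P) (hg : MemLp g 2 P)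
    (h : secondMoment P f g = secondMoment P f f) :
    secondMoment P f f ≤ secondMoment P g g := by
  have h' : secondMoment P g f = secondMoment P f f := by
    rw [← secondMoment_transpose, h, secondMoment_transpose]
  rw [← sub_nonneg]
  have hgf : MemLp (fun ω => g ω - f ω) 2 P := hg.sub hf
  have := secondMoment_self_nonneg hgf
  rw [secondMoment_sub_left hg hf hgf, secondMoment_sub_right hg hg hf,
    secondMoment_sub_right hf hg hf] at this
  rwa [h, h', sub_self, sub_zero] at this

variable [IsProbabilityMeasure P]

/-- Coordinatewise, the measurable factor `Y` is pulled out of the conditional expectation, which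
preserves integrals. -/
theorem secondMoment_condExp_right (hm : m ≤ mΩ) {Y : Ω → Vec k}
    (hYm : StronglyMeasurable[m] Y) (hY : MemLp Y 2 P) (hX : MemLp X 2 P) :
    secondMoment P Y (P[X | m]) = secondMoment P Y X := by
  ext i j
  simp only [secondMoment, Matrix.of_apply]
  have hXi : Integrable X P := hX.integrable (by norm_num)
  have h1 : (fun ω => (P[X | m]) ω j) =ᵐ[P] P[fun ω => X ω j | m] :=
    (EuclideanSpace.proj (𝕜 := ℝ) j).comp_condExp_comm hXi
  have hYi : StronglyMeasurable[m] fun ω => Y ω i :=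
    (EuclideanSpace.proj (𝕜 := ℝ) i).continuous.comp_stronglyMeasurable hYm
  have h2 := condExp_mul_of_stronglyMeasurable_left (μ := P) hYi
    (g := fun ω => X ω j) (integrable_coord_mul hY hX i j)
    ((memLp_coord hX j).integrable (by norm_num))
  rw [← integral_condExp hm (f := fun ω => Y ω i * X ω j)]
  refine integral_congr_ae ?_
  filter_upwards [h1, h2] with ω h1 h2
  rw [h1]
  exact h2.symm

theorem secondMoment_condExp_left (hm : m ≤ mΩ) {Y : Ω → Vec k}
    (hYm : StronglyMeasurable[m] Y) (hY : MemLp Y 2 P) (hX : MemLp X 2 P) :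
    secondMoment P (P[X | m]) Y = secondMoment P X Y := by
  rw [← secondMoment_transpose, secondMoment_condExp_right hm hYm hY hX, secondMoment_transpose]

theorem secondMoment_condExp_le (hm : m ≤ mΩ) (hX : MemLp X 2 P) :
    secondMoment P (P[X | m]) (P[X | m]) ≤ secondMoment P X X :=
  secondMoment_le_of_eq (memLp_condExp hX) hX
    (secondMoment_condExp_right hm stronglyMeasurable_condExp (memLp_condExp hX) hX).symm

/-- A finer σ-algebra has a larger posterior covariance. -/
theorem secondMoment_condExp_mono (hmm : m ≤ m') (hm' : m' ≤ mΩ) (hX : MemLp X 2 P) :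
    secondMoment P (P[X | m]) (P[X | m]) ≤ secondMoment P (P[X | m']) (P[X | m']) := by
  refine secondMoment_le_of_eq (memLp_condExp hX) (memLp_condExp hX) ?_
  -- The coarse posterior mean is measurable for both σ-algebras, so its moments with either
  -- posterior mean equal its moment with `X`.
  rw [secondMoment_condExp_right hm' (stronglyMeasurable_condExp.mono hmm) (memLp_condExp hX) hX,
    secondMoment_condExp_right (hmm.trans hm') stronglyMeasurable_condExp (memLp_condExp hX) hX]

end condExp


/-! ### The response of the receiver -/

section response

variable {Ω : Type*} [MeasurableSpace Ω] {P : Measure Ω} {p q t n : ℕ} {X : Ω → Vec p}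

theorem measurable_signals (hX : Measurable X) (η : Fin 2 → SenderPolicy p) :
    Measurable (signals X η) :=
  measurable_pi_lambda _ fun j => (η j).2.comp hX

theorem comap_signals_le (hX : Measurable X) (η : Fin 2 → SenderPolicy p) :
    MeasurableSpace.comap (signals X η) inferInstance ≤ (inferInstance : MeasurableSpace Ω) :=
  (measurable_signals hX η).comap_le

theorem stronglyMeasurable_response {Ω : Type*} {X : Ω → Vec p} (η : Fin 2 → SenderPolicy p) (γ : ReceiverPolicy p t) :
    StronglyMeasurable[MeasurableSpace.comap (signals X η) inferInstance]
      fun ω => γ.1 (signals X η ω) :=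
  (γ.2.comp (comap_measurable (signals X η))).stronglyMeasurable

theorem memLp_posteriorMean (hX : MemLp X 2 P) (η : Fin 2 → SenderPolicy p) :
    MemLp (posteriorMean P X η) 2 P := memLp_condExp hX

theorem trace_secondMoment_add {f g : Ω → Vec n} (hf : MemLp f 2 P) (hg : MemLp g 2 P)
    (h : (secondMoment P f g).trace = 0) :
    (secondMoment P (fun ω => f ω + g ω) fun ω => f ω + g ω).trace =
      (secondMoment P f f).trace + (secondMoment P g g).trace := by
  have hfg : MemLp (fun ω => f ω + g ω) 2 P := hf.add hg
  have h' : (secondMoment P g f).trace = 0 := by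
    rw [← secondMoment_transpose, Matrix.trace_transpose, h]
  rw [secondMoment_add_left hf hg hfg, secondMoment_add_right hf hf hg,
    secondMoment_add_right hg hf hg]
  simp only [Matrix.trace_add, h, h']
  ring

/-- The gain matrix of the response `u = -K x̂` of the receiver. -/
noncomputable def Losses.gain (𝓛 : Losses p q t) : Matrix (Fin t) (Fin p) ℝ :=
  (𝓛.Rrᵀ * 𝓛.Rr)⁻¹ * 𝓛.Rrᵀ * 𝓛.Qr

theorem Losses.lam_eq (𝓛 : Losses p q t) (i : Fin 2) : 𝓛.lam i = 𝓛.R i * 𝓛.gain := by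
  simp only [Losses.lam, Losses.gain, Matrix.mul_assoc]

/-- The expected loss `𝔼‖Q x - R K x̂‖²` under the linear response. -/
noncomputable def linearResponseCost (P : Measure Ω) (X : Ω → Vec p) (𝓛 : Losses p q t)
    (η : Fin 2 → SenderPolicy p) (Q : Matrix (Fin q) (Fin p) ℝ) (R : Matrix (Fin q) (Fin t) ℝ) :
    ℝ :=
  (secondMoment P (fun ω => act Q (X ω) - act (R * 𝓛.gain) (posteriorMean P X η ω))
    fun ω => act Q (X ω) - act (R * 𝓛.gain) (posteriorMean P X η ω)).trace

variable {𝓛 : Losses p q t} {η : Fin 2 → SenderPolicy p}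

theorem expectedCost_eq (hX2 : MemLp X 2 P) (Q : Matrix (Fin q) (Fin p) ℝ)
    (R : Matrix (Fin q) (Fin t) ℝ) (γ : ReceiverPolicy p t)
    (hγ : MemLp (fun ω => γ.1 (signals X η ω)) 2 P) :
    expectedCost P X Q R η γ = ENNReal.ofReal
      (secondMoment P (fun ω => act Q (X ω) + act R (γ.1 (signals X η ω)))
        fun ω => act Q (X ω) + act R (γ.1 (signals X η ω))).trace :=
  lintegral_norm_sq ((memLp_act Q hX2).add (memLp_act R hγ))

/-- A response of finite cost is square integrable. -/
theorem memLp_response (hX : Measurable X) (hX2 : MemLp X 2 P)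
    (hRr : IsUnit (𝓛.Rrᵀ * 𝓛.Rr)) (γ : ReceiverPolicy p t)
    (h : expectedCost P X 𝓛.Qr 𝓛.Rr η γ ≠ ∞) :
    MemLp (fun ω => γ.1 (signals X η ω)) 2 P := by
  have hmeas : StronglyMeasurable (fun ω => γ.1 (signals X η ω)) :=
    (γ.2.comp (measurable_signals hX η)).stronglyMeasurable
  have h1 : MemLp (fun ω => act 𝓛.Qr (X ω) + act 𝓛.Rr (γ.1 (signals X η ω))) 2 P :=
    memLp_two_of_lintegral_norm_sq (((continuous_act _).comp_stronglyMeasurable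
      hX.stronglyMeasurable).add
        ((continuous_act _).comp_stronglyMeasurable hmeas)).aestronglyMeasurable h
  -- `(Rrᵀ Rr)⁻¹ Rrᵀ` is a left inverse of `Rr`, so it recovers the action from the loss vector
  -- minus `Qr x`.
  have h2 := memLp_act ((𝓛.Rrᵀ * 𝓛.Rr)⁻¹ * 𝓛.Rrᵀ) (h1.sub (memLp_act 𝓛.Qr hX2))
  convert h2 using 2 with ω
  rw [Pi.sub_apply, add_sub_cancel_left, ← act_mul, Matrix.mul_assoc,
    Matrix.nonsing_inv_mul _ ((Matrix.isUnit_iff_isUnit_det _).1 hRr), act_one]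

/-- Doob–Dynkin: the posterior mean is measurable for the σ-algebra of the signals, hence a Borel
function of them. -/
theorem exists_linear_response (P : Measure Ω) (X : Ω → Vec p) (𝓛 : Losses p q t)
    (η : Fin 2 → SenderPolicy p) :
    ∃ γ : ReceiverPolicy p t,
      (fun ω => γ.1 (signals X η ω)) = fun ω => -act 𝓛.gain (posteriorMean P X η ω) := by
  have hm : StronglyMeasurable[MeasurableSpace.comap (signals X η) inferInstance]
      fun ω => -act 𝓛.gain (posteriorMean P X η ω) :=
    ((continuous_act 𝓛.gain).comp_stronglyMeasurable stronglyMeasurable_condExp).neg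
  obtain ⟨h, hh, he⟩ := hm.exists_eq_measurable_comp
  exact ⟨⟨h, hh.measurable⟩, he.symm⟩

theorem expectedCost_linear_response (hX2 : MemLp X 2 P) (Q : Matrix (Fin q) (Fin p) ℝ)
    (R : Matrix (Fin q) (Fin t) ℝ) (γ : ReceiverPolicy p t)
    (hγ : (fun ω => γ.1 (signals X η ω)) =ᵐ[P] fun ω => -act 𝓛.gain (posteriorMean P X η ω)) :
    expectedCost P X Q R η γ = ENNReal.ofReal (linearResponseCost P X 𝓛 η Q R) := by
  have hf : MemLp (fun ω => act Q (X ω) - act (R * 𝓛.gain) (posteriorMean P X η ω)) 2 P :=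
    (memLp_act _ hX2).sub (memLp_act _ (memLp_posteriorMean hX2 η))
  rw [linearResponseCost, ← lintegral_norm_sq hf, expectedCost]
  refine lintegral_congr_ae ?_
  filter_upwards [hγ] with ω hω
  rw [hω, act_mul, act, act, act, act, map_neg, sub_eq_add_neg]

variable [IsProbabilityMeasure P]

/-- Completion of squares for the receiver. -/
theorem trace_receiver_cost (hX : Measurable X) (hX2 : MemLp X 2 P)
    (hRr : IsUnit (𝓛.Rrᵀ * 𝓛.Rr)) {v : Ω → Vec t} (hv : MemLp v 2 P)
    (hvm : StronglyMeasurable[MeasurableSpace.comap (signals X η) inferInstance] v) :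
    (secondMoment P (fun ω => act 𝓛.Qr (X ω) + act 𝓛.Rr (v ω))
      fun ω => act 𝓛.Qr (X ω) + act 𝓛.Rr (v ω)).trace =
    linearResponseCost P X 𝓛 η 𝓛.Qr 𝓛.Rr +
      (secondMoment P (fun ω => act 𝓛.Rr (v ω + act 𝓛.gain (posteriorMean P X η ω)))
        fun ω => act 𝓛.Rr (v ω + act 𝓛.gain (posteriorMean P X η ω))).trace := by
  have hm := comap_signals_le hX η
  have hY := memLp_posteriorMean hX2 η
  have hYm : StronglyMeasurable[MeasurableSpace.comap (signals X η) inferInstance]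
    (posteriorMean P X η) := stronglyMeasurable_condExp
  set Y := posteriorMean P X η with hYdef
  have hw : MemLp (fun ω => v ω + act 𝓛.gain (Y ω)) 2 P := hv.add (memLp_act _ hY)
  have hwm : StronglyMeasurable[MeasurableSpace.comap (signals X η) inferInstance]
      (fun ω => v ω + act 𝓛.gain (Y ω)) :=
    hvm.add ((continuous_act 𝓛.gain).comp_stronglyMeasurable hYm)
  have hYw : secondMoment P Y (fun ω => v ω + act 𝓛.gain (Y ω)) =
      secondMoment P X (fun ω => v ω + act 𝓛.gain (Y ω)) :=
    secondMoment_condExp_left hm hwm hw hX2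
  have hf : MemLp (fun ω => act 𝓛.Qr (X ω) - act (𝓛.Rr * 𝓛.gain) (Y ω)) 2 P :=
    (memLp_act _ hX2).sub (memLp_act _ hY)
  rw [linearResponseCost, ← hYdef, ← trace_secondMoment_add hf (memLp_act _ hw)]
  · have e : ∀ ω, act 𝓛.Qr (X ω) + act 𝓛.Rr (v ω) =
        act 𝓛.Qr (X ω) - act (𝓛.Rr * 𝓛.gain) (Y ω) +
          act 𝓛.Rr (v ω + act 𝓛.gain (Y ω)) := by
      intro ω
      rw [act_mul, act, act, act, act, act, map_add]
      abel
    simp only [e]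
  · rw [secondMoment_act_right _ hf hw, Matrix.trace_mul_comm,
      secondMoment_sub_left (memLp_act _ hX2) (memLp_act _ hY) hw,
      secondMoment_act_left _ hX2 hw, secondMoment_act_left _ hY hw, hYw, ← Matrix.sub_mul,
      ← Matrix.mul_assoc]
    -- The normal equations of the least squares problem, which kill the cross term.
    have e : 𝓛.Rrᵀ * (𝓛.Qr - 𝓛.Rr * 𝓛.gain) = 0 := by
      rw [Matrix.mul_sub, Losses.gain, ← Matrix.mul_assoc, ← Matrix.mul_assoc,
        ← Matrix.mul_assoc, Matrix.mul_nonsing_inv _ ((Matrix.isUnit_iff_isUnit_det _).1 hRr),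
        Matrix.one_mul, sub_self]
    rw [e, Matrix.zero_mul, Matrix.trace_zero]

theorem exists_isBestResponseStrategy (hX : Measurable X) (hX2 : MemLp X 2 P)
    (hRr : IsUnit (𝓛.Rrᵀ * 𝓛.Rr)) :
    ∃ γ, IsBestResponseStrategy P X 𝓛 γ := by
  choose γ hγ using exists_linear_response P X 𝓛
  refine ⟨γ, fun η γ' => ?_⟩
  -- Completing the square needs a square-integrable competitor, which finite cost guarantees.
  by_cases h : expectedCost P X 𝓛.Qr 𝓛.Rr η γ' = ∞
  · rw [h]; exact le_top
  have hv := memLp_response hX hX2 hRr γ' h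
  rw [expectedCost_linear_response hX2 _ _ (γ η) (by rw [hγ η]),
    expectedCost_eq hX2 _ _ γ' hv]
  refine ENNReal.ofReal_le_ofReal ?_
  rw [trace_receiver_cost hX hX2 hRr hv (stronglyMeasurable_response η γ')]
  refine le_add_of_nonneg_right (trace_nonneg_of_nonneg (secondMoment_self_nonneg ?_))
  exact memLp_act _ (hv.add (memLp_act _ (memLp_posteriorMean hX2 η)))

/-- Every best response is almost surely the linear one. -/
theorem IsBestResponseStrategy.ae_eq (hX : Measurable X) (hX2 : MemLp X 2 P)
    (hRr : IsUnit (𝓛.Rrᵀ * 𝓛.Rr)) {γ : (Fin 2 → SenderPolicy p) → ReceiverPolicy p t}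
    (h : IsBestResponseStrategy P X 𝓛 γ) (η : Fin 2 → SenderPolicy p) :
    (fun ω => (γ η).1 (signals X η ω)) =ᵐ[P]
      fun ω => -act 𝓛.gain (posteriorMean P X η ω) := by
  obtain ⟨γ₀, hγ₀⟩ := exists_linear_response P X 𝓛 η
  have hle := h η γ₀
  rw [expectedCost_linear_response hX2 _ _ γ₀ (by rw [hγ₀])] at hle
  have hv := memLp_response hX hX2 hRr (γ η) (ne_top_of_le_ne_top ENNReal.ofReal_ne_top hle)
  have hw := memLp_act 𝓛.Rr (hv.add (memLp_act 𝓛.gain (memLp_posteriorMean hX2 η)))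
  have hf : MemLp (fun ω => act 𝓛.Qr (X ω) -
      act (𝓛.Rr * 𝓛.gain) (posteriorMean P X η ω)) 2 P :=
    (memLp_act _ hX2).sub (memLp_act _ (memLp_posteriorMean hX2 η))
  have hnonneg : 0 ≤ linearResponseCost P X 𝓛 η 𝓛.Qr 𝓛.Rr :=
    trace_nonneg_of_nonneg (secondMoment_self_nonneg hf)
  -- Comparison with the linear response leaves a nonpositive excess term, so `Rr (u + K x̂) = 0`
  -- almost surely.
  rw [expectedCost_eq hX2 _ _ (γ η) hv, ENNReal.ofReal_le_ofReal_iff hnonneg,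
    trace_receiver_cost hX hX2 hRr hv (stronglyMeasurable_response η (γ η)),
    add_le_iff_nonpos_right] at hle
  filter_upwards [ae_eq_zero_of_trace_secondMoment hw hle] with ω hω
  have h2 := congrArg (act ((𝓛.Rrᵀ * 𝓛.Rr)⁻¹ * 𝓛.Rrᵀ)) hω
  rw [← act_mul, Matrix.mul_assoc,
    Matrix.nonsing_inv_mul _ ((Matrix.isUnit_iff_isUnit_det _).1 hRr), act_one,
    Pi.zero_apply, act, map_zero] at h2
  exact eq_neg_of_add_eq_zero_left h2

/-- The loss of a sender is an affine function of the posterior covariance. -/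
theorem linearResponseCost_sender (hX : Measurable X) (hX2 : MemLp X 2 P) (i : Fin 2) :
    linearResponseCost P X 𝓛 η (𝓛.Q i) (𝓛.R i) =
      ((𝓛.Q i)ᵀ * 𝓛.Q i * secondMoment P X X).trace +
        (𝓛.V i * posteriorCovariance P X η).trace := by
  have hm := comap_signals_le hX η
  have hY := memLp_posteriorMean hX2 η
  have hYm : StronglyMeasurable[MeasurableSpace.comap (signals X η) inferInstance]
    (posteriorMean P X η) := stronglyMeasurable_condExp
  have hS : posteriorCovariance P X η =
    secondMoment P (posteriorMean P X η) (posteriorMean P X η) := rfl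
  -- Both cross moments of `x` and `x̂` equal the posterior covariance, so it is the only unknown
  -- left in the cost.
  have hYX : secondMoment P (posteriorMean P X η) X = posteriorCovariance P X η :=
    (secondMoment_condExp_right hm hYm hY hX2).symm
  have hXY : secondMoment P X (posteriorMean P X η) = posteriorCovariance P X η :=
    (secondMoment_condExp_left hm hYm hY hX2).symm
  rw [linearResponseCost, ← Losses.lam_eq]
  have hf : MemLp (fun ω => act (𝓛.Q i) (X ω) - act (𝓛.lam i) (posteriorMean P X η ω)) 2 P :=
    (memLp_act _ hX2).sub (memLp_act _ hY)
  have hQX := memLp_act (𝓛.Q i) hX2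
  have hLY := memLp_act (𝓛.lam i) hY
  rw [secondMoment_sub_left hQX hLY hf, secondMoment_sub_right hQX hQX hLY,
    secondMoment_sub_right hLY hQX hLY, secondMoment_act_left _ hX2 hQX,
    secondMoment_act_left _ hX2 hLY, secondMoment_act_left _ hY hQX,
    secondMoment_act_left _ hY hLY, secondMoment_act_right _ hX2 hX2,
    secondMoment_act_right _ hX2 hY, secondMoment_act_right _ hY hX2,
    secondMoment_act_right _ hY hY, hXY, hYX, ← hS, Losses.V]
  have cyc : ∀ (A B : Matrix (Fin q) (Fin p) ℝ) (M : Matrix (Fin p) (Fin p) ℝ),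
      (A * (M * Bᵀ)).trace = (Bᵀ * A * M).trace := by
    intro A B M
    rw [← Matrix.mul_assoc, Matrix.trace_mul_cycle]
  simp only [Matrix.sub_mul, Matrix.trace_sub, cyc]
  ring

/-- With a best response of the receiver, a sender prefers the policies with the smaller
`Tr (V S)`. -/
theorem IsBestResponseStrategy.expectedCost_le (hX : Measurable X) (hX2 : MemLp X 2 P)
    (hRr : IsUnit (𝓛.Rrᵀ * 𝓛.Rr)) {γ : (Fin 2 → SenderPolicy p) → ReceiverPolicy p t}
    (h : IsBestResponseStrategy P X 𝓛 γ) (i : Fin 2) {η η' : Fin 2 → SenderPolicy p}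
    (hle : (𝓛.V i * posteriorCovariance P X η).trace ≤
      (𝓛.V i * posteriorCovariance P X η').trace) :
    expectedCost P X (𝓛.Q i) (𝓛.R i) η (γ η) ≤
      expectedCost P X (𝓛.Q i) (𝓛.R i) η' (γ η') := by
  rw [expectedCost_linear_response hX2 _ _ _ (h.ae_eq hX hX2 hRr η),
    expectedCost_linear_response hX2 _ _ _ (h.ae_eq hX hX2 hRr η'),
    linearResponseCost_sender hX hX2, linearResponseCost_sender hX hX2]
  exact ENNReal.ofReal_le_ofReal (by linarith)

end response

/-! ### Gaussian states -/

section gaussian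

variable {Ω : Type*} {m mΩ : MeasurableSpace Ω} {P : Measure Ω} {p k : ℕ}
  {X : Ω → Vec p} {Sx : Matrix (Fin p) (Fin p) ℝ}

theorem memLp_of_gaussian (hX : Measurable X) (hlaw : P.map X = multivariateGaussian 0 Sx) :
    MemLp X 2 P := by
  have h : MemLp id 2 (P.map X) := by rw [hlaw]; exact IsGaussian.memLp_two_id
  exact (memLp_map_measure_iff h.1 hX.aemeasurable).1 h

theorem integral_of_gaussian (hX : Measurable X)
    (hlaw : P.map X = multivariateGaussian 0 Sx) : ∫ ω, X ω ∂P = 0 := by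
  have h : ∫ x, x ∂(P.map X) = 0 := by rw [hlaw]; exact integral_id_multivariateGaussian
  rwa [integral_map hX.aemeasurable (by fun_prop)] at h

variable [IsProbabilityMeasure P]

theorem integral_act (hX2 : MemLp X 2 P) (h0 : ∫ ω, X ω ∂P = 0) (A : Matrix (Fin k) (Fin p) ℝ) :
    ∫ ω, act A (X ω) ∂P = 0 := by
  have := (LinearMap.toContinuousLinearMap (Matrix.toEuclideanLin A)).integral_comp_comm
    (hX2.integrable (by norm_num))
  rw [h0, map_zero] at this
  exact this

theorem integral_coord {f : Ω → Vec k} (hf : MemLp f 2 P) (h0 : ∫ ω, f ω ∂P = 0) (j : Fin k) :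
    ∫ ω, f ω j ∂P = 0 := by
  have := (EuclideanSpace.proj (𝕜 := ℝ) j).integral_comp_comm (hf.integrable (by norm_num))
  rw [h0, map_zero] at this
  exact this

theorem covariance_coord {n : ℕ} {f : Ω → Vec n} {g : Ω → Vec k} (hf : MemLp f 2 P)
    (hg : MemLp g 2 P) (h0 : ∫ ω, f ω ∂P = 0) (i : Fin n) (j : Fin k) :
    cov[fun ω => f ω i, fun ω => g ω j; P] = secondMoment P f g i j := by
  rw [covariance_eq_sub (memLp_coord hf i) (memLp_coord hg j), integral_coord hf h0, zero_mul,
    sub_zero]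
  rfl

theorem secondMoment_of_gaussian (hX : Measurable X) (hSx : Sx.PosDef)
    (hlaw : P.map X = multivariateGaussian 0 Sx) : secondMoment P X X = Sx := by
  ext i j
  rw [← covariance_coord (memLp_of_gaussian hX hlaw) (memLp_of_gaussian hX hlaw)
    (integral_of_gaussian hX hlaw), ← covariance_eval_multivariateGaussian (μ := 0)
    hSx.posSemidef i j, ← hlaw, covariance_map (by fun_prop) (by fun_prop) hX.aemeasurable]
  rfl

/-- Uncorrelated linear images of a Gaussian vector are independent. -/
theorem indepFun_act (hX : Measurable X) (hSx : Sx.PosDef)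
    (hlaw : P.map X = multivariateGaussian 0 Sx) {n : ℕ} (A : Matrix (Fin n) (Fin p) ℝ)
    (B : Matrix (Fin k) (Fin p) ℝ) (hAB : A * Sx * Bᵀ = 0) :
    IndepFun (fun ω => act A (X ω)) (fun ω => act B (X ω)) P := by
  have hX2 := memLp_of_gaussian hX hlaw
  have hG : HasGaussianLaw X P := ⟨by rw [hlaw]; infer_instance⟩
  have hjoint : HasGaussianLaw (fun ω => (fun i => act A (X ω) i, fun j => act B (X ω) j)) P := by
    let T : Vec p →L[ℝ] (Fin n → ℝ) × (Fin k → ℝ) := LinearMap.toContinuousLinearMap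
      (((WithLp.linearEquiv 2 ℝ (Fin n → ℝ)).toLinearMap ∘ₗ Matrix.toEuclideanLin A).prod
        ((WithLp.linearEquiv 2 ℝ (Fin k → ℝ)).toLinearMap ∘ₗ Matrix.toEuclideanLin B))
    exact hG.map_of_measurable T T.continuous.measurable
  have h := hjoint.indepFun_of_covariance_eval fun i j => by
    rw [covariance_coord (memLp_act A hX2) (memLp_act B hX2)
      (integral_act hX2 (integral_of_gaussian hX hlaw) A),
      secondMoment_act_left _ hX2 (memLp_act B hX2), secondMoment_act_right _ hX2 hX2,
      secondMoment_of_gaussian hX hSx hlaw, ← Matrix.mul_assoc, hAB, Matrix.zero_apply]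
  exact h.comp (φ := WithLp.toLp 2) (ψ := WithLp.toLp 2) (by fun_prop) (by fun_prop)

/-- If the error `x - A x` is uncorrelated with the observation `B x`, which determines `A x`,
then `A x` is the conditional mean. -/
theorem condExp_of_gaussian (hX : Measurable X) (hSx : Sx.PosDef)
    (hlaw : P.map X = multivariateGaussian 0 Sx) (A : Matrix (Fin p) (Fin p) ℝ)
    (B : Matrix (Fin k) (Fin p) ℝ) (hAB : (1 - A) * Sx * Bᵀ = 0)
    (hm : m ≤ MeasurableSpace.comap (fun ω => act B (X ω)) inferInstance)
    (hA : StronglyMeasurable[m] fun ω => act A (X ω)) :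
    P[X | m] =ᵐ[P] fun ω => act A (X ω) := by
  have hX2 := memLp_of_gaussian hX hlaw
  have hAm : ∀ C : Matrix (Fin p) (Fin p) ℝ, Measurable fun ω => act C (X ω) := fun C =>
    (continuous_act C).measurable.comp hX
  have hBm : Measurable fun ω => act B (X ω) := (continuous_act B).measurable.comp hX
  have hmle := hm.trans hBm.comap_le
  have hind := (IndepFun_iff_Indep _ _ _).1 (indepFun_act hX hSx hlaw (1 - A) B hAB)
  -- The error is independent of `m` and centred, so its conditional mean vanishes.
  have h1 : P[fun ω => act (1 - A) (X ω) | m] =ᵐ[P] fun _ => ∫ ω, act (1 - A) (X ω) ∂P :=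
    condExp_indep_eq (hAm (1 - A)).comap_le hmle
      (comap_measurable _).stronglyMeasurable (indep_of_indep_of_le_right hind hm)
  rw [integral_act hX2 (integral_of_gaussian hX hlaw)] at h1
  have h2 : P[fun ω => act A (X ω) | m] = fun ω => act A (X ω) :=
    condExp_of_stronglyMeasurable hmle hA ((memLp_act A hX2).integrable (by norm_num))
  have h3 := condExp_add ((memLp_act (1 - A) hX2).integrable (by norm_num))
    ((memLp_act A hX2).integrable (by norm_num)) m
  have e : ((fun ω => act (1 - A) (X ω)) + fun ω => act A (X ω)) = X := by
    funext ω
    rw [Pi.add_apply, act_sub, act_one, sub_add_cancel]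
  rw [e, h2] at h3
  filter_upwards [h1, h3] with ω h1 h3
  rw [h3, Pi.add_apply, h1, zero_add]

end gaussian


/-! ### The linear equilibrium -/

section equilibrium

variable {Ω : Type*} [MeasurableSpace Ω] {P : Measure Ω} {p : ℕ} {X : Ω → Vec p}
  {L : Matrix (Fin p) (Fin p) ℝ} {G : Fin 2 → Matrix (Fin p) (Fin p) ℝ}

/-- `Gⱼᵀ` undoes `Gⱼ`, so signal `j` alone determines `L x`, whatever the other sender does. -/
theorem comap_act_le_signals {Ω : Type*} {X : Ω → Vec p} {η : Fin 2 → SenderPolicy p} {j : Fin 2}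
    (hG : (G j)ᵀ * G j = 1) (hη : η j = linearPolicy (G j * L)) :
    MeasurableSpace.comap (fun ω => act L (X ω)) inferInstance ≤
      MeasurableSpace.comap (signals X η) inferInstance := by
  have e : (fun ω => act L (X ω)) = (fun y : Fin 2 → Vec p => act (G j)ᵀ (y j)) ∘ signals X η := by
    funext ω
    have h : signals X η ω j = act (G j * L) (X ω) := by
      rw [signals, hη]; rfl
    rw [Function.comp_apply, h, ← act_mul, ← Matrix.mul_assoc, hG, Matrix.one_mul]
  rw [e, ← MeasurableSpace.comap_comp]
  exact MeasurableSpace.comap_mono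
    ((continuous_act _).measurable.comp (measurable_pi_apply j)).comap_le

theorem comap_signals_linear {Ω : Type*} {X : Ω → Vec p} {η : Fin 2 → SenderPolicy p}
    (hG : ∀ j, (G j)ᵀ * G j = 1) (hη : ∀ j, η j = linearPolicy (G j * L)) :
    MeasurableSpace.comap (signals X η) inferInstance =
      MeasurableSpace.comap (fun ω => act L (X ω)) inferInstance := by
  refine le_antisymm ?_ (comap_act_le_signals (hG 0) (hη 0))
  have e : signals X η = (fun y j => act (G j) y) ∘ fun ω => act L (X ω) := by
    funext ω j
    rw [signals, hη, Function.comp_apply, ← act_mul]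
    rfl
  rw [e, ← MeasurableSpace.comap_comp]
  exact MeasurableSpace.comap_mono
    (measurable_pi_lambda _ fun j => (continuous_act (G j)).measurable).comap_le

variable [IsProbabilityMeasure P] {Sx S : Matrix (Fin p) (Fin p) ℝ}

/-- The posterior covariance induced by the linear policies built from a diagonalization of the
whitened matrix `S`, when the latter is a projection. -/
theorem posteriorCovariance_linear (hX : Measurable X) (hSx : Sx.PosDef)
    (hlaw : P.map X = multivariateGaussian 0 Sx)
    (hid : whiten Sx S * whiten Sx S = whiten Sx S) {U : Matrix (Fin p) (Fin p) ℝ}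
    (hU : U ∈ Matrix.orthogonalGroup (Fin p) ℝ) {d : Fin p → ℝ}
    (hd : whiten Sx S = U * Matrix.diagonal d * Uᵀ)
    (hL : Lᵀ = (CFC.sqrt Sx)⁻¹ * U * Matrix.diagonal d)
    (hG : ∀ j, (G j)ᵀ * G j = 1) {η : Fin 2 → SenderPolicy p}
    (hη : ∀ j, η j = linearPolicy (G j * L)) : posteriorCovariance P X η = S := by
  have hX2 := memLp_of_gaussian hX hlaw
  have hUU : Uᵀ * U = 1 := (Matrix.mem_orthogonalGroup_iff' _ _).1 hU
  have hdet := isUnit_det_sqrt hSx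
  have hRR : CFC.sqrt Sx * CFC.sqrt Sx = Sx := CFC.sqrt_mul_sqrt_self Sx hSx.posSemidef.nonneg
  have hS := conj_whiten hSx S
  have hTt : (whiten Sx S)ᵀ = whiten Sx S := by
    rw [hd]
    simp only [Matrix.transpose_mul, Matrix.transpose_transpose, Matrix.diagonal_transpose,
      mul_assoc]
  have hWt := transpose_inv_sqrt Sx
  have hRt := transpose_sqrt Sx
  have hWR := Matrix.nonsing_inv_mul _ hdet
  have hRW := Matrix.mul_nonsing_inv _ hdet
  set R := CFC.sqrt Sx
  set W := R⁻¹
  set T := whiten Sx S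
  set D := Matrix.diagonal d with hD
  have hDt : Dᵀ = D := Matrix.diagonal_transpose d
  have hL' : L = D * Uᵀ * W := by
    have := congrArg Matrix.transpose hL
    rw [Matrix.transpose_transpose, Matrix.transpose_mul, Matrix.transpose_mul, hDt, hWt] at this
    rw [this, mul_assoc]
  have hTU : T * U = U * D := by rw [hd, mul_assoc, hUU, mul_one]
  -- Idempotence enters here: the columns of `U D` are fixed by `T`, which makes the error
  -- orthogonal to `L x` in `horth`.
  have hTUD : T * (U * D) = U * D := by rw [← hTU, ← mul_assoc, hid]
  -- The estimate factors through the observation `L x`.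
  have hA : R * T * W = R * U * L := by
    rw [hL', hd]
    simp only [mul_assoc]
  have hWSx : W * Sx = R := by rw [← hRR, ← mul_assoc, hWR, one_mul]
  have horth : (1 - R * T * W) * Sx * Lᵀ = 0 := by
    rw [hL, sub_mul, one_mul, mul_assoc (R * T), hWSx, sub_mul]
    calc Sx * (W * U * D) - R * T * R * (W * U * D)
        = R * (R * W) * (U * D) - R * (T * ((R * W) * (U * D))) := by
          rw [← hRR]; simp only [mul_assoc]
      _ = 0 := by rw [hRW, mul_one, one_mul, hTUD, sub_self]
  have hcond : posteriorMean P X η =ᵐ[P] fun ω => act (R * T * W) (X ω) := by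
    rw [posteriorMean, comap_signals_linear hG hη]
    refine condExp_of_gaussian hX hSx hlaw _ L horth le_rfl ?_
    rw [hA]
    simp only [act_mul (R * U) L]
    exact ((continuous_act (R * U)).measurable.comp (comap_measurable _)).stronglyMeasurable
  have hS' : posteriorCovariance P X η =
    secondMoment P (posteriorMean P X η) (posteriorMean P X η) := rfl
  rw [hS', secondMoment_congr hcond hcond, secondMoment_act_left _ hX2 (memLp_act _ hX2),
    secondMoment_act_right _ hX2 hX2, secondMoment_of_gaussian hX hSx hlaw]
  calc R * T * W * (Sx * (R * T * W)ᵀ)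
      = R * T * ((W * Sx) * W) * (T * R) := by
        rw [Matrix.transpose_mul, Matrix.transpose_mul, hWt, hRt, hTt]
        simp only [mul_assoc]
    _ = R * (T * T) * R := by rw [hWSx, hRW, mul_one]; simp only [mul_assoc]
    _ = S := by rw [hid, hS]

/-- A policy pair in which one sender uses the linear policy reveals at least as much as that
policy, and at most the state. -/
theorem posteriorCovariance_mem_Icc (hX : Measurable X) (hSx : Sx.PosDef)
    (hlaw : P.map X = multivariateGaussian 0 Sx) (hG : ∀ j, (G j)ᵀ * G j = 1)
    {η η' : Fin 2 → SenderPolicy p} (hη : ∀ j, η j = linearPolicy (G j * L)) {j : Fin 2}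
    (hη' : η' j = η j) :
    posteriorCovariance P X η' ∈ Set.Icc (posteriorCovariance P X η) Sx := by
  have hX2 := memLp_of_gaussian hX hlaw
  constructor
  · refine secondMoment_condExp_mono ?_ (comap_signals_le hX η') hX2
    rw [comap_signals_linear hG hη]
    exact comap_act_le_signals (hG j) (hη'.trans (hη j))
  · rw [← secondMoment_of_gaussian hX hSx hlaw]
    exact secondMoment_condExp_le (comap_signals_le hX η') hX2

end equilibrium

end SignalingGame

theorem theorem1 {Ω : Type*} [MeasurableSpace Ω] (P : Measure Ω) [IsProbabilityMeasure P]
    (p q t : ℕ) (𝓛 : SignalingGame.Losses p q t) (hRr : IsUnit (𝓛.Rrᵀ * 𝓛.Rr))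
    (Sx : Matrix (Fin p) (Fin p) ℝ) (hSx : Sx.PosDef)
    (X : Ω → SignalingGame.Vec p) (hX : Measurable X)
    (hlaw : P.map X = multivariateGaussian 0 Sx)
    (i : Fin 2) (S₁ Sstar : Matrix (Fin p) (Fin p) ℝ)
    (hS : SignalingGame.IsAlgorithmOutput Sx 𝓛 i S₁ Sstar)
    (U : Matrix (Fin p) (Fin p) ℝ) (hU : U ∈ Matrix.orthogonalGroup (Fin p) ℝ)
    (d : Fin p → ℝ)
    (hd : SignalingGame.whiten Sx Sstar = U * Matrix.diagonal d * Uᵀ)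
    (L : Matrix (Fin p) (Fin p) ℝ)
    (hL : Lᵀ = (CFC.sqrt Sx)⁻¹ * U * Matrix.diagonal d)
    (G : Fin 2 → Matrix (Fin p) (Fin p) ℝ) (hG : ∀ j, (G j)ᵀ * G j = 1)
    (η : Fin 2 → SignalingGame.SenderPolicy p)
    (hη : ∀ j, η j = SignalingGame.linearPolicy (G j * L)) :
    -- a best-response strategy of the receiver exists, and with every one of them
    -- the linear policies are in equilibrium
    (∃ γ, SignalingGame.IsBestResponseStrategy P X 𝓛 γ) ∧
    (∀ γ, SignalingGame.IsBestResponseStrategy P X 𝓛 γ →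
      SignalingGame.IsEquilibrium P X 𝓛 η γ) ∧
    -- the posterior covariance of the receiver is the computed one, and it has the stated form
    SignalingGame.posteriorCovariance P X η = Sstar ∧
    ∃ Pr : Matrix (Fin p) (Fin p) ℝ, IsStarProjection Pr ∧
      Sstar = S₁ + CFC.sqrt (Sx - S₁) * Pr * CFC.sqrt (Sx - S₁) := by
  have hX2 := SignalingGame.memLp_of_gaussian hX hlaw
  obtain ⟨h₁, h₂⟩ := hS
  have hS₁ := h₁.mem_Icc
  have hSs := h₂.mem_Icc
  have hT₁ : SignalingGame.whiten Sx S₁ * SignalingGame.whiten Sx S₁ =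
      SignalingGame.whiten Sx S₁ :=
    h₁.whiten_mul_self hSx le_rfl (by simp [SignalingGame.whiten])
  have hT := h₂.whiten_mul_self hSx hS₁.1 hT₁
  have hcov : SignalingGame.posteriorCovariance P X η = Sstar :=
    SignalingGame.posteriorCovariance_linear hX hSx hlaw hT hU hd hL hG hη
  refine ⟨SignalingGame.exists_isBestResponseStrategy hX hX2 hRr, fun γ hγ => ⟨hγ, ?_⟩, hcov, ?_⟩
  · intro j η'
    refine hγ.expectedCost_le hX hX2 hRr j ?_
    -- The sender `j.rev` who does not deviate keeps `L x` revealed.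
    have hmem := SignalingGame.posteriorCovariance_mem_Icc hX hSx hlaw hG hη
      (η' := Function.update η j η') (j := j.rev)
      (Function.update_of_ne (by fin_cases j <;> decide) _ _)
    rw [hcov] at hmem ⊢
    have hj : j = i ∨ j = i.rev := by fin_cases i <;> fin_cases j <;> decide
    -- The sender treated first needs the translation argument; for the second, a smaller interval
    -- suffices.
    rcases hj with rfl | rfl
    · exact h₁.trace_le_of_le hSs.1 hmem
    · exact h₂.trace_le ⟨hSs.1.trans hmem.1, hmem.2⟩
  · have h0T₁ : 0 ≤ SignalingGame.whiten Sx S₁ := by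
      have := SignalingGame.whiten_mono (Sx := Sx) hS₁.1
      rwa [show SignalingGame.whiten Sx 0 = 0 by simp [SignalingGame.whiten]] at this
    have hle : SignalingGame.whiten Sx S₁ ≤ SignalingGame.whiten Sx Sstar :=
      SignalingGame.whiten_mono hSs.1
    have hle1 : SignalingGame.whiten Sx Sstar ≤ 1 := by
      rw [← SignalingGame.whiten_self hSx]; exact SignalingGame.whiten_mono hSs.2
    have hT₁t := SignalingGame.transpose_eq_of_nonneg h0T₁
    have hTt := SignalingGame.transpose_eq_of_nonneg (h0T₁.trans hle)
    have e1 := SignalingGame.mul_eq_of_isIdempotent_le hT₁t hT₁ hle hle1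
    have e2 := congrArg Matrix.transpose e1
    rw [Matrix.transpose_mul, hT₁t, hTt] at e2
    have c0 := SignalingGame.conj_one hSx
    have c1 := SignalingGame.conj_whiten hSx S₁
    have c2 := SignalingGame.conj_whiten hSx Sstar
    set T₁ := SignalingGame.whiten Sx S₁
    set T := SignalingGame.whiten Sx Sstar
    have hMR : CFC.sqrt (Sx - S₁) * CFC.sqrt (Sx - S₁) =
        CFC.sqrt Sx * (1 - T₁) * CFC.sqrt Sx := by
      rw [CFC.sqrt_mul_sqrt_self _ (sub_nonneg.2 hS₁.2), mul_sub, sub_mul, c0, c1]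
    -- `T₁ ≤ T` are nested projections, so `T - T₁` is a projection below `1 - T₁`.
    obtain ⟨Pr, hPr, hPr'⟩ := SignalingGame.exists_isStarProjection_conj (Z := T - T₁)
      (CFC.sqrt_nonneg (Sx - S₁)) (SignalingGame.transpose_sqrt Sx)
      (SignalingGame.isUnit_det_sqrt hSx) hMR
      (by rw [Matrix.transpose_sub, Matrix.transpose_one, hT₁t])
      (by rw [sub_mul, one_mul, mul_sub, mul_one, hT₁, sub_self, sub_zero])
      (by rw [Matrix.transpose_sub, hTt, hT₁t])
      (by rw [sub_mul, mul_sub, mul_sub, hT, e1, e2, hT₁, sub_self, sub_zero])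
      (by rw [sub_mul, one_mul, mul_sub, e2, hT₁, sub_self, sub_zero])
    refine ⟨Pr, hPr, ?_⟩
    rw [← hPr', mul_sub, sub_mul, c2, c1, add_sub_cancel]
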